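/- Every Hausdorff topological group $G$ embeds, as a topological subgroup, into an extremely amenable Hausdorff topological group: there are a Hausdorff topological group $H$ and a group homomorphism $\iota\colon G\to H$ which is a homeomorphism onto its image, such that $H$ has the fixed point on compacta property, i.e. for every continuous action $H\times X\to X$ on a non-empty compact Hausdorff space $X$ there is a point $x^\ast\in X$ with $h\cdot x^\ast=x^\ast$ for all $h\in H$. In particular, every Hausdorff topological group embeds as a topological subgroup into an amenable one; indeed the same $H$ is amenable. Here a topological group $H$ is amenable if there is a linear functional $\phi$ on the space $C^b_r(H)$ which is positive, of norm one for the supremum norm, and satisfies $\phi(f)=\phi(h\cdot f)$ for all $h\in H$ and $f\in C^b_r(H)$, where $C^b_r(H)$ is the space of bounded functions $f\colon H\to\mathbb R$ such that for every $\varepsilon>0$ there is a neighbourhood $V$ of the identity with $|f(x)-f(y)|<\varepsilon$ whenever $xy^{-1}\in V$, and $(h\cdot f)(x)=f(h^{-1}x)$. -/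

import Mathlib

open scoped BoundedContinuousFunction

universe u v

/-- A topological group `G` has the *fixed point on compacta property* (is *extremely amenable*)
if every continuous action of `G` on a nonempty compact Hausdorff space `X` has a common fixed
point. The spaces `X` are taken in the universe of `G`; the theorem
`HasFixedPointOnCompacta.exists_fixed` shows that the property then holds for nonempty compact
Hausdorff spaces in every universe. -/
def HasFixedPointOnCompacta (G : Type u) [Group G] [TopologicalSpace G] : Prop :=
  ∀ (X : Type u) [TopologicalSpace X] [CompactSpace X] [T2Space X] [Nonempty X]
    [MulAction G X] [ContinuousSMul G X], ∃ x : X, ∀ g : G, g • x = x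

/-- The choice of universe in `HasFixedPointOnCompacta` is immaterial. -/
theorem HasFixedPointOnCompacta.exists_fixed {G : Type u} [Group G] [TopologicalSpace G]
    (hG : HasFixedPointOnCompacta G) (X : Type v) [TopologicalSpace X] [CompactSpace X]
    [T2Space X] [Nonempty X] [MulAction G X] [ContinuousSMul G X] :
    ∃ x : X, ∀ g : G, g • x = x := by
  obtain ⟨x₀⟩ := ‹Nonempty X›
  let o : G → X := fun g => g • x₀
  let Y : Set X := closure (Set.range o)
  have hY : ∀ (g : G) (y : X), y ∈ Y → g • y ∈ Y := by
    intro g y hy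
    refine map_mem_closure (continuous_const_smul g) hy ?_
    rintro _ ⟨h, rfl⟩
    exact ⟨g * h, mul_smul g h x₀⟩
  have hsm : Small.{u} Y := by
    refine small_of_injective (β := Filter G)
      (f := fun y : Y => Filter.comap o (nhds (y : X))) ?_
    intro y z hyz
    have hne : (Filter.comap o (nhds (y : X))).NeBot :=
      Filter.comap_neBot fun t ht => by
        obtain ⟨_, hw, g, rfl⟩ := mem_closure_iff_nhds.1 y.2 t ht
        exact ⟨g, hw⟩
    have h1 : Filter.Tendsto o (Filter.comap o (nhds (y : X))) (nhds (y : X)) :=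
      Filter.tendsto_comap
    have h2 : Filter.Tendsto o (Filter.comap o (nhds (y : X))) (nhds (z : X)) := by
      have : Filter.comap o (nhds (y : X)) = Filter.comap o (nhds (z : X)) := hyz
      rw [this]
      exact Filter.tendsto_comap
    exact Subtype.ext (tendsto_nhds_unique h1 h2)
  let e : Y ≃ₜ Shrink.{u} Y := Shrink.homeomorph Y
  have : CompactSpace Y := isCompact_iff_compactSpace.1 isClosed_closure.isCompact
  have : CompactSpace (Shrink.{u} Y) := e.compactSpace
  have : T2Space (Shrink.{u} Y) := e.t2Space
  have : Nonempty (Shrink.{u} Y) := ⟨e ⟨o 1, subset_closure ⟨1, rfl⟩⟩⟩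
  let act : MulAction G (Shrink.{u} Y) :=
    { smul := fun g s => e ⟨g • (e.symm s : X), hY g _ (e.symm s).2⟩
      one_smul := fun s => by
        change e ⟨(1 : G) • (e.symm s : X), _⟩ = s
        simp
      mul_smul := fun g h s => by
        change e ⟨(g * h) • (e.symm s : X), _⟩ =
          e ⟨g • (e.symm (e ⟨h • (e.symm s : X), _⟩) : X), _⟩
        simp [mul_smul] }
  have : ContinuousSMul G (Shrink.{u} Y) := by
    constructor
    change Continuous fun p : G × Shrink.{u} Y =>
      e ⟨p.1 • (e.symm p.2 : X), hY p.1 _ (e.symm p.2).2⟩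
    have := e.symm.continuous
    fun_prop
  obtain ⟨s, hs⟩ := hG (Shrink.{u} Y)
  refine ⟨(e.symm s : X), fun g => ?_⟩
  have h : e ⟨g • (e.symm s : X), hY g _ (e.symm s).2⟩ = s := hs g
  have h' := congrArg e.symm h
  rw [e.symm_apply_apply] at h'
  exact congrArg Subtype.val h'

/-- The normed space `C^b(G)` of bounded real functions on `G` that are uniformly continuous for
the right uniformity, whose basic entourages are `{(x, y) | y * x⁻¹ ∈ V}` for `V` a neighbourhood
of the identity; the norm is the supremum norm. -/
def rightUniformBCF (G : Type u) [Group G] [TopologicalSpace G] [IsTopologicalGroup G] :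
    Submodule ℝ (G →ᵇ ℝ) where
  carrier := {f | @UniformContinuous G ℝ (IsTopologicalGroup.rightUniformSpace G) _ f}
  zero_mem' := by
    let _ := IsTopologicalGroup.rightUniformSpace G
    exact uniformContinuous_const
  add_mem' := by
    let _ := IsTopologicalGroup.rightUniformSpace G
    intro f g hf hg
    exact UniformContinuous.add hf hg
  smul_mem' := by
    let _ := IsTopologicalGroup.rightUniformSpace G
    intro c f hf
    exact UniformContinuous.const_smul hf c

/-- The left action of `G` on `C^b(G)`: `(g · f)(x) = f (g⁻¹ * x)`. -/
def rightUniformBCF.translate {G : Type u} [Group G] [TopologicalSpace G] [IsTopologicalGroup G]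
    (g : G) (f : rightUniformBCF G) : rightUniformBCF G :=
  ⟨(f : G →ᵇ ℝ).compContinuous (ContinuousMap.mulLeft g⁻¹), by
    let _ := IsTopologicalGroup.rightUniformSpace G
    have hf : UniformContinuous (f : G →ᵇ ℝ) := f.2
    have hg : UniformContinuous (fun x : G => g⁻¹ * x) := by
      change Filter.Tendsto _ (Filter.comap (fun p : G × G => p.2 * p.1⁻¹) (nhds 1))
        (Filter.comap (fun p : G × G => p.2 * p.1⁻¹) (nhds 1))
      rw [Filter.tendsto_comap_iff]
      have hc : Filter.Tendsto (fun z : G => g⁻¹ * z * g) (nhds 1) (nhds 1) := by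
        have : Continuous fun z : G => g⁻¹ * z * g := by fun_prop
        simpa using this.tendsto 1
      refine (hc.comp Filter.tendsto_comap).congr fun p => ?_
      simp [mul_assoc]
    exact hf.comp hg⟩

/-- A topological group `G` is *amenable* if it has an invariant mean: a linear functional on
`C^b(G)` which is positive, of norm one (`1` is the supremum of its absolute values on the closed
unit ball), and invariant under the left action of `G`. -/
def IsAmenableGroup (G : Type u) [Group G] [TopologicalSpace G] [IsTopologicalGroup G] : Prop :=
  ∃ φ : rightUniformBCF G →ₗ[ℝ] ℝ,
    (∀ f : rightUniformBCF G, (∀ x : G, 0 ≤ (f : G →ᵇ ℝ) x) → 0 ≤ φ f) ∧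
    IsLUB ((fun f => |φ f|) '' {f : rightUniformBCF G | ‖f‖ ≤ 1}) 1 ∧
    ∀ (g : G) (f : rightUniformBCF G), φ (rightUniformBCF.translate g f) = φ f

/-! For each `n` take a finite `(n + 1)`-uniform hypergraph that is not `(n + 1)`-colourable
although any `n` of its edges are solvable in `G` (`hasSparseRamsey`, a partite construction). On
the space of sequences `y` with `y n` a set of at most `n` edges, form the group of finite-range
`G`-valued functions, with convergence in the submeasure that gives `{y | a ∉ y n}` weight `1 / (n +
1)`. Total weight below `1` never covers the space, so `G` embeds as the constants
(`StepGroup.isInducing_const`).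

Given functions `g j` and a large `n`, solve at each `y` the edges in `y n` for the constraint that
the labels be `g j y * b` with a common `b`. The solutions are group elements indexed by vertices. A
colouring of the group thus colours the hypergraph, and a monochromatic edge `a` gives elements of
one colour that equal `g j * h` wherever `a ∈ y n`, hence up to small weight
(`StepGroup.isOscillationStable`). This Ramsey property yields fixed points by compactness. Applied
to the compact space of means, the fixed point property yields amenability. -/

/-- The edges `a ∈ s` of a hypergraph with incidence map `ends : E → J → V` can be solved in `G`:
for all nonempty right-invariant constraints `R a ⊆ G ^ J` there is a labelling of the vertices
by elements of `G` satisfying the constraint at each `a ∈ s`. -/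
def EdgesSolvable (G : Type u) [Group G] {J V E : Type} (ends : E → J → V) (s : Finset E) : Prop :=
  ∀ R : E → Set (J → G), (∀ a, (R a).Nonempty) → (∀ a, ∀ ρ ∈ R a, ∀ g, (fun j => ρ j * g) ∈ R a) →
    ∃ x : V → G, ∀ a ∈ s, x ∘ ends a ∈ R a

/-- There is a finite `J`-uniform hypergraph that is not `r`-colourable and in which any `N` edges
are solvable in `G`. -/
def HasSparseRamsey (G : Type u) [Group G] (r N : ℕ) (J : Type) : Prop :=
  ∃ (V E : Type) (_ : Finite V) (_ : Finite E) (ends : E → J → V),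
    (∀ c : V → Fin r, ∃ a, ∀ j j', c (ends a j) = c (ends a j')) ∧
    ∀ s : Finset E, s.card ≤ N → EdgesSolvable G ends s

/-- A `J`-uniform hypergraph with vertices partitioned into parts indexed by `I`, whose edges meet
each part at most once, such that any `N` edges are solvable and every `r`-colouring which is
constant on each part outside `K` has a monochromatic edge. -/
def HasPartiteRamsey (G : Type u) [Group G] (r N : ℕ) (J I : Type) (K : Set I) : Prop :=
  ∃ (V E : Type) (_ : Finite V) (_ : Finite E) (ends : E → J → V) (part : V → I),
    (∀ a, Function.Injective (part ∘ ends a)) ∧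
    (∀ c : V → Fin r, (∀ v w, part v = part w → part v ∉ K → c v = c w) →
      ∃ a, ∀ j j', c (ends a j) = c (ends a j')) ∧
    ∀ s : Finset E, s.card ≤ N → EdgesSolvable G ends s

/-! ### Sparse Ramsey hypergraphs by the partite construction. -/

section SparseRamsey

variable {G : Type u} [Group G] {r N : ℕ} {J I : Type}

theorem exists_embedding_monochromatic (r : ℕ) (J : Type) [Finite J]
    (c : Fin (r * Nat.card J + 1) → Fin r) :
    ∃ β : J ↪ Fin (r * Nat.card J + 1), ∀ j j', c (β j) = c (β j') := by
  classical
  have := Fintype.ofFinite J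
  obtain ⟨k, hk⟩ := Fintype.exists_lt_card_fiber_of_mul_lt_card (n := Nat.card J) c (by simp)
  obtain ⟨F, hF, hcard⟩ : ∃ F : Finset (Fin (r * Nat.card J + 1)),
      (∀ x ∈ F, c x = k) ∧ Nat.card J ≤ F.card :=
    ⟨_, fun x hx => (Finset.mem_filter.1 hx).2, hk.le⟩
  obtain ⟨β⟩ : Nonempty (J ↪ F) := Function.Embedding.nonempty_of_card_le (by
    rw [Fintype.card_coe, ← Nat.card_eq_fintype_card]
    exact hcard)
  have hβ : ∀ j, c (β j) = k := fun j => hF _ (β j).2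
  exact ⟨β.trans (Function.Embedding.subtype _), fun j j' => (hβ j).trans (hβ j').symm⟩

theorem hasSparseRamsey_zero [Finite J] : HasSparseRamsey G r 0 J := by
  refine ⟨Fin (r * Nat.card J + 1), J ↪ Fin (r * Nat.card J + 1), inferInstance, inferInstance,
    fun β => β, exists_embedding_monochromatic r J, fun s hs R _ _ => ⟨1, ?_⟩⟩
  simp [Finset.card_eq_zero.1 (Nat.le_zero.1 hs)]

theorem hasPartiteRamsey_empty (G : Type u) [Group G] (hr : 0 < r) (N : ℕ) (J : Type) [Finite J] :
    HasPartiteRamsey G r N J (Fin (r * Nat.card J + 1)) ∅ := by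
  refine ⟨(J ↪ Fin (r * Nat.card J + 1)) × J, J ↪ Fin (r * Nat.card J + 1), inferInstance,
    inferInstance, fun β j => (β, j), fun v => v.1 v.2, fun β => β.injective, fun c hc => ?_,
    fun s _ R hR _ => ?_⟩
  · have hd : ∀ i, ∃ k, ∀ v : (J ↪ Fin (r * Nat.card J + 1)) × J, v.1 v.2 = i → c v = k := by
      intro i
      by_cases hi : ∃ v : (J ↪ Fin (r * Nat.card J + 1)) × J, v.1 v.2 = i
      · obtain ⟨w, hw⟩ := hi
        exact ⟨c w, fun v hv => hc v w (hv.trans hw.symm) (Set.notMem_empty _)⟩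
      -- A part has no vertices when `J` is empty; any colour serves.
      · exact ⟨⟨0, hr⟩, fun v hv => (hi ⟨v, hv⟩).elim⟩
    choose d hd using hd
    obtain ⟨β, hβ⟩ := exists_embedding_monochromatic r J d
    exact ⟨β, fun j j' => by simpa only [hd _ (β, _) rfl] using hβ j j'⟩
  · choose ρ hρ using hR
    exact ⟨fun v => ρ v.1 v.2, fun β _ => hρ β⟩

/-- If at most one edge is to be solved, and it meets `X` at most once, then the labels on `X` can
be prescribed. -/
theorem exists_solution_extending {V E : Type} {ends : E → J → V} {X : Set V}
    (hinj : ∀ a, Function.Injective (ends a))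
    (hX : ∀ a j j', ends a j ∈ X → ends a j' ∈ X → j = j')
    {s : Finset E} (hs : s.card ≤ 1) {R : E → Set (J → G)} (hR : ∀ a, (R a).Nonempty)
    (hRG : ∀ a, ∀ ρ ∈ R a, ∀ g, (fun j => ρ j * g) ∈ R a) (y : V → G) :
    ∃ x : V → G, (∀ a ∈ s, x ∘ ends a ∈ R a) ∧ ∀ v ∈ X, x v = y v := by
  rcases s.eq_empty_or_nonempty with rfl | ⟨a, ha⟩
  · exact ⟨y, by simp, fun _ _ => rfl⟩
  have hsa : ∀ b ∈ s, b = a := fun b hb => Finset.card_le_one.1 hs b hb a ha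
  obtain ⟨ρ, hρ, hρX⟩ : ∃ ρ ∈ R a, ∀ j, ends a j ∈ X → ρ j = y (ends a j) := by
    obtain ⟨ρ, hρ⟩ := hR a
    by_cases h : ∃ j, ends a j ∈ X
    · obtain ⟨j, hj⟩ := h
      -- One right translation corrects the label at the only vertex of the edge in `X`.
      refine ⟨_, hRG a ρ hρ ((ρ j)⁻¹ * y (ends a j)), fun j' hj' => ?_⟩
      obtain rfl := hX a j j' hj hj'
      simp
    · exact ⟨ρ, hρ, fun j hj => (h ⟨j, hj⟩).elim⟩
  refine ⟨Function.extend (ends a) ρ y, fun b hb => ?_, fun v hv => ?_⟩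
  · obtain rfl := hsa b hb
    have : Function.extend (ends b) ρ y ∘ ends b = ρ := funext fun j => (hinj b).extend_apply _ _ j
    rwa [this]
  · by_cases h : ∃ j, ends a j = v
    · obtain ⟨j, rfl⟩ := h
      rw [(hinj a).extend_apply, hρX j hv]
    · rw [Function.extend_apply' _ _ _ h]

/-- Copies of the given system are glued along part `i`, following a sparse hypergraph whose edges
have the size of that part. A monochromatic edge of the latter is a copy whose part `i` has constant
colour, so `K` can grow by `i`. Among `2 * N + 1` edges at most `N` copies contain two or more.
These copies are solved together by sparsity of the gluing hypergraph; any other copy has at most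
one edge, which meets part `i` at most once and so accepts every labelling of that part. -/
theorem HasPartiteRamsey.insert {K : Set I} (i : I)
    (hsp : ∀ X : Type, Finite X → HasSparseRamsey G r N X)
    (h : HasPartiteRamsey G r (2 * N + 1) J I K) :
    HasPartiteRamsey G r (2 * N + 1) J I (insert i K) := by
  classical
  obtain ⟨V, E, hV, hE, ends, part, hinj, hcol, hsol⟩ := h
  obtain ⟨Y, B, hY, hB, glue, hcolY, hsolY⟩ := hsp {v // part v = i} inferInstance
  let copy : B → V → Y ⊕ (B × V) := fun b v =>
    if hv : part v = i then Sum.inl (glue b ⟨v, hv⟩) else Sum.inr (b, v)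
  let part' : Y ⊕ (B × V) → I := Sum.elim (fun _ => i) fun p => part p.2
  have hpart : ∀ b v, part' (copy b v) = part v := by
    intro b v
    by_cases hv : part v = i <;> simp [copy, part', hv]
  refine ⟨Y ⊕ (B × V), B × E, inferInstance, inferInstance, fun p => copy p.1 ∘ ends p.2, part',
    fun p => ?_, fun c hc => ?_, fun s hs R hR hRG => ?_⟩
  · have : part' ∘ copy p.1 ∘ ends p.2 = part ∘ ends p.2 := funext fun j => hpart _ _
    rw [this]
    exact hinj p.2
  · obtain ⟨b, hb⟩ := hcolY (c ∘ Sum.inl)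
    obtain ⟨a, ha⟩ := hcol (c ∘ copy b) fun v w hvw hv => by
      by_cases hvi : part v = i
      · have hwi : part w = i := hvw ▸ hvi
        simpa [copy, hvi, hwi] using hb ⟨v, hvi⟩ ⟨w, hwi⟩
      · refine hc _ _ (by rw [hpart, hpart, hvw]) ?_
        rw [hpart]
        simp [hvi, hv]
    exact ⟨(b, a), ha⟩
  · have := Fintype.ofFinite B
    let t : B → Finset E := fun b => (s.filter fun p => p.1 = b).image Prod.snd
    have ht : ∀ b a, a ∈ t b ↔ (b, a) ∈ s := fun b a => by simp [t]
    have htcard : ∀ b, (t b).card = (s.filter fun p => p.1 = b).card := fun b =>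
      Finset.card_image_of_injOn fun p hp q hq hpq => by
        simp only [Finset.coe_filter, Set.mem_ofPred_eq] at hp hq
        exact Prod.ext (hp.2.trans hq.2.symm) hpq
    let T : Finset B := Finset.univ.filter fun b => 2 ≤ (t b).card
    have hT : T.card ≤ N := by
      have h1 : 2 * T.card ≤ ∑ b ∈ T, (t b).card := by
        rw [mul_comm, ← smul_eq_mul]
        exact Finset.card_nsmul_le_sum _ _ _ fun b hb => (Finset.mem_filter.1 hb).2
      have h2 : ∑ b ∈ T, (t b).card ≤ s.card := by
        simp only [htcard]
        rw [Finset.card_eq_sum_card_fiberwise (f := Prod.fst) (t := Finset.univ)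
          (fun _ _ => Finset.mem_coe.2 (Finset.mem_univ _))]
        exact Finset.sum_le_sum_of_subset (Finset.subset_univ _)
      omega
    -- The constraint at `b`: the labels on part `i` extend to a solution of the selected edges in
    -- copy `b`.
    obtain ⟨y, hy⟩ := hsolY T hT
      (fun b => {z | ∃ x : V → G, (∀ a ∈ t b, x ∘ ends a ∈ R (b, a)) ∧ ∀ v, x v.1 = z v})
      (fun b => by
        obtain ⟨x, hx⟩ := hsol (t b) ((htcard b).trans_le ((Finset.card_filter_le _ _).trans hs))
          (fun a => R (b, a)) (fun a => hR _) (fun a => hRG _)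
        exact ⟨fun v => x v.1, x, hx, fun _ => rfl⟩)
      (by
        rintro b z ⟨x, hx, hxz⟩ g
        exact ⟨fun v => x v * g, fun a ha => hRG _ _ (hx a ha) g, fun v => congrArg (· * g) (hxz v)⟩)
    have hext : ∀ b, ∃ x : V → G, (∀ a ∈ t b, x ∘ ends a ∈ R (b, a)) ∧
        ∀ v : {v // part v = i}, x v.1 = y (glue b v) := by
      intro b
      by_cases hb : 2 ≤ (t b).card
      · exact hy b (Finset.mem_filter.2 ⟨Finset.mem_univ _, hb⟩)
      · obtain ⟨x, hx, hxX⟩ := exists_solution_extending (X := {v | part v = i})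
          (fun a => (hinj a).of_comp)
          (fun a j j' hj hj' => hinj a (hj.trans hj'.symm)) (by omega : (t b).card ≤ 1)
          (R := fun a => R (b, a)) (fun a => hR _) (fun a => hRG _)
          (fun v => if hv : part v = i then y (glue b ⟨v, hv⟩) else 1)
        exact ⟨x, hx, fun v => (hxX v.1 v.2).trans (dif_pos v.2)⟩
    choose x hx hxy using hext
    refine ⟨Sum.elim y fun p => x p.1 p.2, fun p hp => ?_⟩
    have hcopy : ∀ b, Sum.elim y (fun p : B × V => x p.1 p.2) ∘ copy b = x b := by
      intro b
      funext v
      by_cases hv : part v = i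
      · simp [copy, hv, hxy b ⟨v, hv⟩]
      · simp [copy, hv]
    rw [← Function.comp_assoc, hcopy]
    exact hx p.1 p.2 ((ht _ _).2 hp)

/-- Gluing along every part in turn frees the colouring of all restrictions and takes `N` to `2 * N
+ 1 ≥ N + 1`. -/
theorem hasSparseRamsey (G : Type u) [Group G] (hr : 0 < r) (N : ℕ) (J : Type) [Finite J] :
    HasSparseRamsey G r N J := by
  induction N generalizing J with
  | zero => exact hasSparseRamsey_zero
  | succ N ih =>
    have hK : ∀ K : Finset (Fin (r * Nat.card J + 1)),
        HasPartiteRamsey G r (2 * N + 1) J (Fin (r * Nat.card J + 1)) K := by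
      intro K
      induction K using Finset.induction_on with
      | empty => simpa using hasPartiteRamsey_empty G hr (2 * N + 1) J
      | insert i K _ hK =>
        rw [Finset.coe_insert]
        exact hK.insert i fun X _ => ih X
    obtain ⟨V, E, hV, hE, ends, part, -, hcol, hsol⟩ := hK Finset.univ
    exact ⟨V, E, hV, hE, ends, fun c => hcol c fun v w _ hv => (hv (by simp)).elim,
      fun s hs => hsol s (by omega)⟩

end SparseRamsey

/-! ### From oscillation stability to fixed points. -/

section OscillationStable

open Filter Topology Uniformity

/-- For every finite colouring of `K`, every finite `F ⊆ K` has a translate `F * h` that is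
monochromatic up to an arbitrarily small left perturbation. -/
def IsOscillationStable (K : Type u) [Group K] [TopologicalSpace K] : Prop :=
  ∀ O ∈ 𝓝 (1 : K), ∀ (F : Finset K) (r : ℕ) (c : K → Fin r), ∃ (h : K) (w : K → K),
    (∀ f ∈ F, w f * (f * h)⁻¹ ∈ O) ∧ ∀ f ∈ F, ∀ f' ∈ F, c (w f) = c (w f')

variable {K : Type u} [Group K] [TopologicalSpace K]

theorem eventually_forall_smul_mem_entourage {X : Type v} [UniformSpace X] [CompactSpace X]
    [MulAction K X] [ContinuousSMul K X] {W : Set (X × X)} (hW : W ∈ 𝓤 X) :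
    ∀ᶠ g in 𝓝 (1 : K), ∀ x : X, (g • x, x) ∈ W := by
  have := isCompact_univ.eventually_forall_of_forall_eventually (X := K) (Y := X)
    (x₀ := (1 : K)) (K := Set.univ) (P := fun g x => (g • x, x) ∈ W) fun x _ => by
      have hc : Continuous fun p : K × X => (p.1 • p.2, p.2) := by fun_prop
      refine hc.continuousAt.eventually (?_ : ∀ᶠ p in 𝓝 ((1 : K) • x, x), p ∈ W)
      rw [one_smul]
      exact nhds_le_uniformity x hW
  simpa using this

/-- By compactness it suffices to find points moved little by finitely many elements. Colour `g` by
a small ball containing `g • x₀`; a nearly monochromatic `F * h` makes `h • x₀` such a point. -/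
theorem IsOscillationStable.hasFixedPointOnCompacta (hK : IsOscillationStable K) :
    HasFixedPointOnCompacta K := by
  classical
  intro X _ _ _ _ _ _
  let _ : UniformSpace X := uniformSpaceOfCompactR1
  obtain ⟨x₀⟩ := ‹Nonempty X›
  let ι := K × {W : Set (X × X) // W ∈ 𝓤 X ∧ IsClosed W}
  have key : (Set.univ ∩ ⋂ i : ι, {z : X | (i.1 • z, z) ∈ i.2.1}).Nonempty := by
    refine isCompact_univ.inter_iInter_nonempty _ (fun i => ?_) fun s => ?_
    · exact i.2.2.2.preimage ((continuous_const_smul i.1).prodMk continuous_id)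
    have hU : (⋂ i ∈ s, i.2.1) ∈ 𝓤 X := (Filter.biInter_finset_mem s).2 fun i _ => i.2.2.1
    obtain ⟨W₁, hW₁, hW₁s, hW₁U⟩ := comp_symm_mem_uniformity_sets hU
    obtain ⟨W, hW, hWs, hWW₁⟩ := comp_symm_mem_uniformity_sets hW₁
    obtain ⟨t, htf, ht⟩ := (isCompact_univ (X := X)).totallyBounded W hW
    have hcol : ∀ g : K, ∃ y : t, (g • x₀, y.1) ∈ W := fun g => by
      simpa using ht (Set.mem_univ (g • x₀))
    choose c hc using hcol
    have := htf.to_subtype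
    obtain ⟨r, ⟨e⟩⟩ := Finite.exists_equiv_fin t
    -- Including `1` puts `h • x₀` itself near the common ball.
    obtain ⟨h, w, hw, hwc⟩ := hK _ (eventually_forall_smul_mem_entourage (K := K) hW)
      (insert 1 (s.image Prod.fst)) r (e ∘ c)
    have hnear : ∀ f ∈ insert 1 (s.image Prod.fst), (w f • x₀, (f * h) • x₀) ∈ W := fun f hf => by
      have := hw f hf ((f * h) • x₀)
      rwa [smul_smul, inv_mul_cancel_right] at this
    refine ⟨h • x₀, Set.mem_univ _, Set.mem_iInter₂.2 fun i hi => ?_⟩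
    have h1 : (1 : K) ∈ insert 1 (s.image Prod.fst) := Finset.mem_insert_self _ _
    have hf : i.1 ∈ insert 1 (s.image Prod.fst) :=
      Finset.mem_insert_of_mem (Finset.mem_image_of_mem _ hi)
    have hcc : c (w i.1) = c (w 1) := e.injective (hwc _ hf _ h1)
    have hsymm : ∀ {x y : X}, (x, y) ∈ W → (y, x) ∈ W := fun hxy => SetRel.symm W hxy
    have hA : ((i.1 * h) • x₀, (c (w i.1)).1) ∈ W₁ :=
      hWW₁ ⟨_, hsymm (hnear _ hf), hc _⟩
    have hB : ((c (w i.1)).1, h • x₀) ∈ W₁ := by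
      refine hWW₁ ⟨w 1 • x₀, ?_, by simpa using hnear 1 h1⟩
      rw [hcc]
      exact hsymm (hc _)
    have hAB : (i.1 • h • x₀, h • x₀) ∈ ⋂ i ∈ s, i.2.1 := by
      rw [smul_smul]
      exact hW₁U ⟨_, hA, hB⟩
    exact Set.mem_iInter₂.1 hAB i hi
  obtain ⟨z, -, hz⟩ := key
  refine ⟨z, fun g => ?_⟩
  refine eq_of_uniformity_basis uniformity_hasBasis_closed fun {W} hW => ?_
  exact Set.mem_iInter.1 hz ⟨g, W, hW⟩

end OscillationStable

/-! ### The group of step functions and its submeasure topology. -/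

section StepGroup

open Filter Topology

/-- Sequences of finite sets `y n ⊆ E n` with at most `n` elements. -/
abbrev SubsetSeq (E : ℕ → Type) : Type := ∀ n, {s : Finset (E n) // s.card ≤ n}

/-- The group of functions `Q → G` with finite range. -/
def finiteRangeSubgroup (Q : Type v) (G : Type u) [Group G] : Subgroup (Q → G) where
  carrier := {f | (Set.range f).Finite}
  one_mem' := (Set.finite_singleton 1).subset (by rintro _ ⟨y, rfl⟩; rfl)
  mul_mem' := fun {f g} hf hg => (hf.mul hg).subset (by
    rintro _ ⟨y, rfl⟩
    exact Set.mul_mem_mul ⟨y, rfl⟩ ⟨y, rfl⟩)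
  inv_mem' := fun {f} hf => hf.inv.subset (by
    rintro _ ⟨y, rfl⟩
    simp)

/-- The group of finite-range functions `SubsetSeq E → G`, topologized by the neighbourhoods
`stepNhd` of the identity. -/
def StepGroup (E : ℕ → Type) (G : Type u) [Group G] : Type u :=
  finiteRangeSubgroup (SubsetSeq E) G

namespace StepGroup

variable {E : ℕ → Type} {G : Type u} [Group G]

instance : Group (StepGroup E G) := inferInstanceAs (Group (finiteRangeSubgroup (SubsetSeq E) G))

instance : CoeFun (StepGroup E G) fun _ => SubsetSeq E → G := ⟨Subtype.val⟩

@[simp] theorem mul_apply (f g : StepGroup E G) (y : SubsetSeq E) : (f * g) y = f y * g y := rfl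

@[simp] theorem inv_apply (f : StepGroup E G) (y : SubsetSeq E) : f⁻¹ y = (f y)⁻¹ := rfl

theorem finite_range (f : StepGroup E G) : (Set.range f).Finite := f.2

/-- The functions with values in `U` outside of the union of the sets `{y | a ∉ y n}`,
`(n, a) ∈ t`, for some `t` of total weight less than `ε`, where `(n, a)` has weight
`1 / (n + 1)`. -/
def stepNhd (E : ℕ → Type) (U : Set G) (ε : ℝ) : Set (StepGroup E G) :=
  {f | ∃ t : Finset (Σ n, E n), ∑ p ∈ t, ((p.1 : ℝ) + 1)⁻¹ < ε ∧
    ∀ y : SubsetSeq E, (∀ p ∈ t, p.2 ∈ (y p.1).1) → f y ∈ U}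

theorem stepNhd_mono {U U' : Set G} (hU : U ⊆ U') {ε ε' : ℝ} (hε : ε ≤ ε') :
    stepNhd E U ε ⊆ stepNhd E U' ε' := by
  rintro f ⟨t, ht, hf⟩
  exact ⟨t, ht.trans_le hε, fun y hy => hU (hf y hy)⟩

/-- Weight below `1` leaves at most `n` elements of `t` at level `n`, so they fit into one `y n`. -/
theorem exists_forall_mem_of_sum_lt_one (t : Finset (Σ n, E n))
    (ht : ∑ p ∈ t, ((p.1 : ℝ) + 1)⁻¹ < 1) : ∃ y : SubsetSeq E, ∀ p ∈ t, p.2 ∈ (y p.1).1 := by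
  classical
  have hcard : ∀ n, (t.preimage (Sigma.mk n) sigma_mk_injective.injOn).card ≤ n := by
    intro n
    by_contra! h
    have hle : ∑ p ∈ t.filter fun p => p.1 = n, ((p.1 : ℝ) + 1)⁻¹ ≤
        ∑ p ∈ t, ((p.1 : ℝ) + 1)⁻¹ :=
      Finset.sum_le_sum_of_subset_of_nonneg (Finset.filter_subset _ _)
        fun _ _ _ => by positivity
    have hsub : (t.preimage (Sigma.mk n) sigma_mk_injective.injOn).card ≤
        (t.filter fun p => p.1 = n).card := by
      refine Finset.card_le_card_of_injOn (Sigma.mk n) (fun a ha => ?_) sigma_mk_injective.injOn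
      have : (⟨n, a⟩ : Σ n, E n) ∈ t := by simpa using ha
      simpa using this
    have heq : ∑ p ∈ t.filter fun p => p.1 = n, ((p.1 : ℝ) + 1)⁻¹ =
        (t.filter fun p => p.1 = n).card * ((n : ℝ) + 1)⁻¹ := by
      rw [← nsmul_eq_mul]
      exact Finset.sum_eq_card_nsmul fun p hp => by rw [(Finset.mem_filter.1 hp).2]
    have hn : ((n : ℝ) + 1) ≤ (t.filter fun p => p.1 = n).card := by
      exact_mod_cast h.trans_le hsub
    have : (1 : ℝ) ≤ (t.filter fun p => p.1 = n).card * ((n : ℝ) + 1)⁻¹ := by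
      rw [← div_eq_mul_inv, one_le_div (by positivity)]
      exact hn
    linarith
  exact ⟨fun n => ⟨_, hcard n⟩, fun p hp => by simpa using hp⟩

variable [TopologicalSpace G] [IsTopologicalGroup G]

instance groupFilterBasis : GroupFilterBasis (StepGroup E G) where
  sets := {S | ∃ U ∈ 𝓝 (1 : G), ∃ ε > 0, S = stepNhd E U ε}
  nonempty := ⟨_, Set.univ, univ_mem, 1, one_pos, rfl⟩
  inter_sets := by
    rintro _ _ ⟨U, hU, ε, hε, rfl⟩ ⟨U', hU', ε', hε', rfl⟩
    exact ⟨_, ⟨U ∩ U', inter_mem hU hU', min ε ε', lt_min hε hε', rfl⟩, Set.subset_inter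
      (stepNhd_mono Set.inter_subset_left (min_le_left _ _))
      (stepNhd_mono Set.inter_subset_right (min_le_right _ _))⟩
  one' := by
    rintro _ ⟨U, hU, ε, hε, rfl⟩
    exact ⟨∅, by simpa using hε, fun _ _ => mem_of_mem_nhds hU⟩
  mul' := by
    classical
    rintro _ ⟨U, hU, ε, hε, rfl⟩
    obtain ⟨V, hV, hVU⟩ := exists_nhds_one_split hU
    refine ⟨_, ⟨V, hV, ε / 2, half_pos hε, rfl⟩, ?_⟩
    rintro _ ⟨f, ⟨t, ht, hf⟩, g, ⟨t', ht', hg⟩, rfl⟩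
    refine ⟨t ∪ t', ?_, fun y hy => hVU _ (hf y fun p hp => hy p (Finset.mem_union_left _ hp)) _
      (hg y fun p hp => hy p (Finset.mem_union_right _ hp))⟩
    have := Finset.sum_union_inter (s₁ := t) (s₂ := t') (f := fun p => ((p.1 : ℝ) + 1)⁻¹)
    have : 0 ≤ ∑ p ∈ t ∩ t', ((p.1 : ℝ) + 1)⁻¹ := Finset.sum_nonneg fun _ _ => by positivity
    linarith
  inv' := by
    rintro _ ⟨U, hU, ε, hε, rfl⟩
    refine ⟨_, ⟨U⁻¹, inv_mem_nhds_one G hU, ε, hε, rfl⟩, ?_⟩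
    rintro f ⟨t, ht, hf⟩
    exact ⟨t, ht, hf⟩
  conj' := by
    rintro k _ ⟨U, hU, ε, hε, rfl⟩
    -- Finite range is what makes this a neighbourhood: only finitely many conjugations occur.
    have hV : (⋂ x ∈ Set.range k, (fun z : G => x * z * x⁻¹) ⁻¹' U) ∈ 𝓝 (1 : G) := by
      refine (biInter_mem k.finite_range).2 fun x _ => ?_
      have : Continuous fun z : G => x * z * x⁻¹ := by fun_prop
      exact this.continuousAt.preimage_mem_nhds (by simpa using hU)
    refine ⟨_, ⟨_, hV, ε, hε, rfl⟩, ?_⟩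
    rintro f ⟨t, ht, hf⟩
    exact ⟨t, ht, fun y hy => Set.mem_iInter₂.1 (hf y hy) (k y) ⟨y, rfl⟩⟩

instance : TopologicalSpace (StepGroup E G) := groupFilterBasis.topology

instance : IsTopologicalGroup (StepGroup E G) := groupFilterBasis.isTopologicalGroup

theorem mem_nhds_one_iff {O : Set (StepGroup E G)} :
    O ∈ 𝓝 1 ↔ ∃ U ∈ 𝓝 (1 : G), ∃ ε > 0, stepNhd E U ε ⊆ O := by
  rw [groupFilterBasis.nhds_one_hasBasis.mem_iff]
  constructor
  · rintro ⟨_, ⟨U, hU, ε, hε, rfl⟩, h⟩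
    exact ⟨U, hU, ε, hε, h⟩
  · rintro ⟨U, hU, ε, hε, h⟩
    exact ⟨_, ⟨U, hU, ε, hε, rfl⟩, h⟩

/-- The embedding of `G` as constant functions. -/
def const (E : ℕ → Type) (G : Type u) [Group G] : G →* StepGroup E G where
  toFun g := ⟨fun _ => g, (Set.finite_singleton g).subset (by rintro _ ⟨y, rfl⟩; rfl)⟩
  map_one' := rfl
  map_mul' _ _ := rfl

theorem isInducing_const : IsInducing (const E G) := by
  refine IsTopologicalGroup.isInducing_iff_nhds_one.2 (le_antisymm ?_ fun U hU => ?_)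
  · rintro S ⟨O, hO, hOS⟩
    obtain ⟨U, hU, ε, hε, h⟩ := mem_nhds_one_iff.1 hO
    exact mem_of_superset hU fun g hg => hOS (h ⟨∅, by simpa using hε, fun _ _ => hg⟩)
  · refine ⟨stepNhd E U 1, mem_nhds_one_iff.2 ⟨U, hU, 1, one_pos, subset_rfl⟩, ?_⟩
    rintro g ⟨t, ht, hg⟩
    obtain ⟨y, hy⟩ := exists_forall_mem_of_sum_lt_one t ht
    exact hg y hy

/-- A single pair `(n, a)` serves as exceptional set, of weight `1 / (n + 1)`; `n` is large enough
to list `F` by `Fin (n + 1)`, to have `n + 1` colours at hand, and to make this weight less than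
`ε`. -/
theorem isOscillationStable {V : ℕ → Type} (ends : ∀ n, E n → Fin (n + 1) → V n)
    (hcol : ∀ n (c : V n → Fin (n + 1)), ∃ a, ∀ j j', c (ends n a j) = c (ends n a j'))
    (hsol : ∀ n (s : Finset (E n)), s.card ≤ n → EdgesSolvable G (ends n) s)
    (hE : ∀ n, Finite (E n)) : IsOscillationStable (StepGroup E G) := by
  classical
  intro O hO F r c
  obtain ⟨U, hU, ε, hε, hUO⟩ := mem_nhds_one_iff.1 hO
  obtain ⟨m, hm⟩ := exists_nat_one_div_lt hε
  obtain ⟨n, hFn, hrn, hmn⟩ : ∃ n, F.card ≤ n + 1 ∧ r ≤ n + 1 ∧ m ≤ n :=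
    ⟨F.card + r + m, by omega, by omega, by omega⟩
  have hn : ((n : ℝ) + 1)⁻¹ < ε := by
    refine lt_of_le_of_lt ?_ hm
    rw [one_div]
    gcongr
  obtain ⟨g, hg⟩ : ∃ g : Fin (n + 1) → StepGroup E G, ∀ f ∈ F, ∃ j, g j = f := by
    obtain ⟨e⟩ : Nonempty (F ↪ Fin (n + 1)) :=
      Function.Embedding.nonempty_of_card_le (by simpa using hFn)
    -- The unused indices are padded with `1`.
    exact ⟨Function.extend e Subtype.val 1, fun f hf => ⟨e ⟨f, hf⟩, e.injective.extend_apply _ _ _⟩⟩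
  have hx : ∀ (s : {s : Finset (E n) // s.card ≤ n}) (γ : Fin (n + 1) → G), ∃ x : V n → G,
      ∀ a ∈ s.1, ∃ b, ∀ j, x (ends n a j) = γ j * b := by
    intro s γ
    obtain ⟨x, hx⟩ := hsol n s.1 s.2 (fun _ => {ρ | ∃ b, ∀ j, ρ j = γ j * b})
      (fun _ => ⟨γ, 1, by simp⟩)
      (by
        rintro _ ρ ⟨b, hb⟩ k
        exact ⟨b * k, fun j => by simp only [hb, mul_assoc]⟩)
    exact ⟨x, hx⟩
  choose x hx using hx
  -- The range is finite because `u v` at `y` depends only on `y n` and on the values `g j y`.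
  let u : V n → StepGroup E G := fun v => ⟨fun y => x (y n) (fun j => g j y) v, by
    have hfin : (Set.univ ×ˢ Set.univ.pi fun j => Set.range (g j) :
        Set ({s : Finset (E n) // s.card ≤ n} × (Fin (n + 1) → G))).Finite :=
      Set.finite_univ.prod (Set.Finite.pi fun j => (g j).finite_range)
    refine (hfin.image fun p => x p.1 p.2 v).subset ?_
    rintro _ ⟨y, rfl⟩
    exact ⟨(y n, fun j => g j y), ⟨Set.mem_univ _, fun j _ => ⟨y, rfl⟩⟩, rfl⟩⟩
  obtain ⟨a, ha⟩ := hcol n fun v => Fin.castLE hrn (c (u v))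
  choose! j hj using hg
  -- Where `a ∈ y n`, this translate takes the value `b`, so `u (ends n a j)` agrees there with `g j
  -- * h` exactly.
  refine ⟨(g 0)⁻¹ * u (ends n a 0), fun f => u (ends n a (j f)), fun f hf => hUO ?_,
    fun f _ f' _ => Fin.castLE_injective hrn (ha _ _)⟩
  refine ⟨{⟨n, a⟩}, by simpa using hn, fun y hy => ?_⟩
  obtain ⟨b, hb⟩ := hx (y n) (fun j => g j y) a (hy ⟨n, a⟩ (Finset.mem_singleton_self _))
  have hu : ∀ j, u (ends n a j) y = g j y * b := hb
  have : f y = g (j f) y := by rw [hj f hf]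
  simp only [mul_apply, inv_apply, hu, this]
  simpa using mem_of_mem_nhds hU

end StepGroup

end StepGroup

/-! ### Amenability from a fixed mean. -/

section Amenable

open Filter Topology

variable {H : Type u} [Group H] [TopologicalSpace H] [IsTopologicalGroup H]

namespace rightUniformBCF

/-- The constant function `1`. -/
def one (H : Type u) [Group H] [TopologicalSpace H] [IsTopologicalGroup H] : rightUniformBCF H :=
  ⟨BoundedContinuousFunction.const H 1, by
    let _ := IsTopologicalGroup.rightUniformSpace H
    exact uniformContinuous_const⟩

@[simp] theorem one_apply (x : H) : (one H : H →ᵇ ℝ) x = 1 := rfl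

@[simp] theorem translate_apply (g : H) (f : rightUniformBCF H) (x : H) :
    (translate g f : H →ᵇ ℝ) x = (f : H →ᵇ ℝ) (g⁻¹ * x) := rfl

theorem ext {f g : rightUniformBCF H} (h : ∀ x, (f : H →ᵇ ℝ) x = (g : H →ᵇ ℝ) x) : f = g :=
  Subtype.ext (BoundedContinuousFunction.ext h)

/-- Since `(h * x) * (h₀ * x)⁻¹ = h * h₀⁻¹` for every `x`, right uniform continuity gives a bound
uniform in `x`. -/
theorem continuous_translate_inv (f : rightUniformBCF H) :
    Continuous fun h : H => (translate h⁻¹ f : H →ᵇ ℝ) := by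
  refine continuous_iff_continuousAt.2 fun h₀ => Metric.tendsto_nhds.2 fun ε hε => ?_
  have hf : {p : H × H | dist ((f : H →ᵇ ℝ) p.1) ((f : H →ᵇ ℝ) p.2) < ε / 2} ∈
      comap (fun p : H × H => p.2 * p.1⁻¹) (𝓝 1) :=
    (show Tendsto _ _ _ from f.2) (Metric.dist_mem_uniformity (half_pos hε))
  obtain ⟨V, hV, hVf⟩ := hf
  have hc : ContinuousAt (fun h : H => h * h₀⁻¹) h₀ := by fun_prop
  filter_upwards [hc.preimage_mem_nhds (by simpa using hV)] with h hh
  refine lt_of_le_of_lt ?_ (half_lt_self hε)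
  refine (BoundedContinuousFunction.dist_le (half_pos hε).le).2 fun x => ?_
  have : ((h₀ * x, h * x) : H × H) ∈ (fun p : H × H => p.2 * p.1⁻¹) ⁻¹' V := by
    simpa [mul_assoc] using hh
  rw [dist_comm]
  simpa using (hVf this).le

end rightUniformBCF

open rightUniformBCF

/-- The means on `C^b(H)`: positive linear functionals with value `1` at the constant `1`. -/
def means (H : Type u) [Group H] [TopologicalSpace H] [IsTopologicalGroup H] :
    Set (rightUniformBCF H → ℝ) :=
  {Λ | (∀ f g, Λ (f + g) = Λ f + Λ g) ∧ (∀ (c : ℝ) f, Λ (c • f) = c * Λ f) ∧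
    (∀ f : rightUniformBCF H, (∀ x, 0 ≤ (f : H →ᵇ ℝ) x) → 0 ≤ Λ f) ∧ Λ (one H) = 1}

theorem means.sub_le_norm {Λ : rightUniformBCF H → ℝ} (hΛ : Λ ∈ means H)
    (f g : rightUniformBCF H) : Λ f - Λ g ≤ ‖(f : H →ᵇ ℝ) - g‖ := by
  obtain ⟨c, hc⟩ : ∃ c, c = ‖(f : H →ᵇ ℝ) - g‖ := ⟨_, rfl⟩
  have hpos := hΛ.2.2.1 (c • one H + ((-1 : ℝ) • f + g)) fun x => by
    have h1 := (le_abs_self _).trans (((f : H →ᵇ ℝ) - g).norm_coe_le_norm x)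
    have h2 : (f : H →ᵇ ℝ) x - (g : H →ᵇ ℝ) x ≤ c := hc ▸ h1
    change 0 ≤ c * 1 + (-1 * (f : H →ᵇ ℝ) x + (g : H →ᵇ ℝ) x)
    linarith
  rw [hΛ.1, hΛ.1, hΛ.2.1, hΛ.2.1, hΛ.2.2.2] at hpos
  linarith

theorem means.abs_sub_le_norm {Λ : rightUniformBCF H → ℝ} (hΛ : Λ ∈ means H)
    (f g : rightUniformBCF H) : |Λ f - Λ g| ≤ ‖(f : H →ᵇ ℝ) - g‖ := by
  refine abs_sub_le_iff.2 ⟨means.sub_le_norm hΛ f g, ?_⟩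
  rw [norm_sub_rev]
  exact means.sub_le_norm hΛ g f

theorem means.abs_le_norm {Λ : rightUniformBCF H → ℝ} (hΛ : Λ ∈ means H)
    (f : rightUniformBCF H) : |Λ f| ≤ ‖(f : H →ᵇ ℝ)‖ := by
  have h0 : Λ ((0 : ℝ) • f) = 0 := by rw [hΛ.2.1, zero_mul]
  have hz : (f : H →ᵇ ℝ) - (((0 : ℝ) • f : rightUniformBCF H) : H →ᵇ ℝ) = f := by
    ext x
    change (f : H →ᵇ ℝ) x - 0 * (f : H →ᵇ ℝ) x = _
    ring
  have := means.abs_sub_le_norm hΛ f ((0 : ℝ) • f)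
  rwa [h0, sub_zero, hz] at this

theorem isCompact_means : IsCompact (means H) := by
  refine (isCompact_univ_pi fun f : rightUniformBCF H =>
    isCompact_Icc (a := -‖(f : H →ᵇ ℝ)‖) (b := ‖(f : H →ᵇ ℝ)‖)).of_isClosed_subset ?_ fun Λ hΛ f _ =>
      abs_le.1 (means.abs_le_norm hΛ f)
  simp only [means, Set.ofPred_and, Set.ofPred_forall]
  refine IsClosed.inter ?_ (IsClosed.inter ?_ (IsClosed.inter ?_ ?_))
  · exact isClosed_iInter fun f => isClosed_iInter fun g =>
      isClosed_eq (by fun_prop) (by fun_prop)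
  · exact isClosed_iInter fun c => isClosed_iInter fun g =>
      isClosed_eq (by fun_prop) (by fun_prop)
  · exact isClosed_iInter fun f => isClosed_iInter fun _ =>
      isClosed_le (by fun_prop) (by fun_prop)
  · exact isClosed_eq (by fun_prop) (by fun_prop)

instance : MulAction H (means H) where
  smul h Λ := ⟨fun f => Λ.1 (translate h⁻¹ f),
    fun f g => Λ.2.1 (translate h⁻¹ f) (translate h⁻¹ g),
    fun c f => Λ.2.2.1 c (translate h⁻¹ f), fun f hf => Λ.2.2.2.1 _ fun x => hf _, Λ.2.2.2.2⟩
  one_smul Λ := Subtype.ext <| funext fun f => congrArg Λ.1 <| ext fun x => by simp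
  mul_smul g h Λ := Subtype.ext <| funext fun f => congrArg Λ.1 <| ext fun x => by
    simp [mul_assoc]

theorem means.smul_apply (h : H) (Λ : means H) (f : rightUniformBCF H) :
    (h • Λ).1 f = Λ.1 (translate h⁻¹ f) := rfl

instance : ContinuousSMul H (means H) where
  continuous_smul := by
    refine Continuous.subtype_mk (continuous_pi fun f => ?_) _
    refine continuous_iff_continuousAt.2 fun p => ?_
    have h1 : Tendsto (fun q : H × means H => q.2.1 (translate p.1⁻¹ f)) (𝓝 p)
        (𝓝 (p.2.1 (translate p.1⁻¹ f))) :=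
      ((continuous_apply (translate p.1⁻¹ f)).comp
        (continuous_subtype_val.comp continuous_snd)).continuousAt
    have h2 : Tendsto (fun q : H × means H =>
        ‖(translate q.1⁻¹ f : H →ᵇ ℝ) - translate p.1⁻¹ f‖) (𝓝 p) (𝓝 0) := by
      have hc : Continuous fun q : H × means H =>
          ‖(translate q.1⁻¹ f : H →ᵇ ℝ) - translate p.1⁻¹ f‖ :=
        (((continuous_translate_inv f).comp continuous_fst).sub continuous_const).norm
      simpa using hc.tendsto p
    -- Means are 1-Lipschitz, so moving the function costs the same for all means at once; this
    -- gives joint continuity.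
    have h3 : Tendsto (fun q : H × means H =>
        q.2.1 (translate q.1⁻¹ f) - q.2.1 (translate p.1⁻¹ f)) (𝓝 p) (𝓝 0) :=
      squeeze_zero_norm (fun q => means.abs_sub_le_norm q.2.2 _ _) h2
    have h4 := h3.add h1
    simp only [sub_add_cancel, zero_add] at h4
    exact h4

theorem HasFixedPointOnCompacta.isAmenableGroup (hH : HasFixedPointOnCompacta H) :
    IsAmenableGroup H := by
  have : CompactSpace (means H) := isCompact_iff_compactSpace.1 isCompact_means
  -- Evaluation at the identity is a mean.
  have : Nonempty (means H) := ⟨⟨fun f => (f : H →ᵇ ℝ) 1, fun _ _ => rfl, fun _ _ => rfl,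
    fun _ hf => hf 1, rfl⟩⟩
  obtain ⟨Λ, hΛ⟩ := hH (means H)
  refine ⟨{ toFun := Λ.1, map_add' := Λ.2.1, map_smul' := Λ.2.2.1 }, Λ.2.2.2.1, ⟨?_, ?_⟩,
    fun g f => ?_⟩
  · rintro _ ⟨f, hf, rfl⟩
    exact (means.abs_le_norm Λ.2 f).trans hf
  · intro b hb
    refine hb ⟨one H, ?_, ?_⟩
    · exact (BoundedContinuousFunction.norm_le zero_le_one).2 fun x => by simp
    · exact (congrArg abs Λ.2.2.2.2).trans abs_one
  · have := congrArg (fun Λ : means H => Λ.1 f) (hΛ g⁻¹)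
    simp only [means.smul_apply, inv_inv] at this
    exact this

end Amenable

theorem HasFixedPointOnCompacta.of_surjective {K : Type u} {H : Type u} [Group K]
    [TopologicalSpace K] [Group H] [TopologicalSpace H] (π : K →* H) (hπ : Continuous π)
    (hsurj : Function.Surjective π) (hK : HasFixedPointOnCompacta K) :
    HasFixedPointOnCompacta H := by
  intro X _ _ _ _ _ _
  let _ : MulAction K X := MulAction.compHom X π
  have : ContinuousSMul K X :=
    ⟨(hπ.comp continuous_fst).smul continuous_snd⟩
  obtain ⟨x, hx⟩ := hK X
  refine ⟨x, fun h => ?_⟩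
  obtain ⟨k, rfl⟩ := hsurj h
  exact hx k

theorem mainTheorem3 (G : Type u) [Group G] [TopologicalSpace G] [IsTopologicalGroup G]
    [T2Space G] :
    ∃ (H : Type u) (_ : Group H) (_ : TopologicalSpace H) (_ : IsTopologicalGroup H)
      (_ : T2Space H) (ι : G →* H),
      Topology.IsEmbedding ι ∧ HasFixedPointOnCompacta H ∧ IsAmenableGroup H := by
  choose V E _ hE ends hcol hsol using fun n : ℕ =>
    hasSparseRamsey (r := n + 1) G n.succ_pos n (Fin (n + 1))
  -- The quotient makes the group Hausdorff and keeps the map from `G` inducing; it is then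
  -- injective because `G` is Hausdorff.
  have hfix : HasFixedPointOnCompacta (SeparationQuotient (StepGroup E G)) :=
    (StepGroup.isOscillationStable ends hcol hsol hE).hasFixedPointOnCompacta.of_surjective
      SeparationQuotient.mkMonoidHom SeparationQuotient.continuous_mk
      SeparationQuotient.surjective_mk
  have hind : Topology.IsInducing
      ((SeparationQuotient.mkMonoidHom (M := StepGroup E G)).comp (StepGroup.const E G)) :=
    SeparationQuotient.isInducing_mk.comp StepGroup.isInducing_const
  exact ⟨SeparationQuotient (StepGroup E G), inferInstance, inferInstance, inferInstance,
    inferInstance, _, ⟨hind, hind.injective⟩, hfix, hfix.isAmenableGroup⟩
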